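/- Let $X$ be a compact abelian group with a translation-invariant metric $d$ inducing its topology, let $\mathscr B$ be its Borel $\sigma$-algebra and $\mu$ its normalized Haar measure, and let $Tx=x+x_0$ be an ergodic rotation of $(X,\mathscr B,\mu)$ which is aperiodic (that is, for every $n\ge 1$, $T^nx\neq x$ for $\mu$-a.e. $x$). Let $f\in L^\infty(X,\mathscr B,\mu)$ be real-valued with $f\ge c$ for some constant $c>0$, and write $f^{(n)}(x)=f(x)+f(Tx)+\dots+f(T^{n-1}x)$ for $n\ge 1$. Let $P'\subset\mathbb R$ be compact and $\eta_0>0$. Assume that for every $0<\eta<\eta_0$ and every $\epsilon>0$ there is $\kappa>0$ such that for every $N\in\mathbb N$ there are $\delta>0$ and $Z'\in\mathscr B$ with $\mu(Z')>1-\epsilon$ with the following property: if $x,x'\in Z'$ and $0<d(x,x')<\delta$, then there are integers $M_1,M_2,L_1,L_2\ge N$ with $\frac{L_1}{M_1},\frac{L_2}{M_2}\ge\kappa$ and a number $p\in P'$ such that $$\frac1{L_1}\left|\{n\in\mathbb Z\cap[M_1,M_1+L_1]:\ |f^{(n)}(x)-f^{(n)}(x')-p|<\epsilon\}\right|>1-\epsilon$$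 and $$\frac1{L_2}\left|\{n\in\mathbb Z\cap[M_2,M_2+L_2]:\ |f^{(n)}(x)-f^{(n)}(x')-p-\eta|<\epsilon\}\right|>1-\epsilon .$$ Let $\mathcal T^f=(T^f_t)_{t\in\mathbb R}$ be the special flow over $T$ under $f$: it acts on $X^f=\{(x,s)\in X\times\mathbb R:\ 0\le s<f(x)\}$, equipped with the restriction $\mu^f$ of $\mu\otimes\mathrm{Leb}$, by $T^f_t(x,s)=(T^nx,\,s+t-f^{(n)}(x))$, where $n\in\mathbb Z$ is the unique integer with $f^{(n)}(x)\le s+t<f^{(n+1)}(x)$ (and $f^{(0)}=0$, $f^{(-n)}(x)=-f^{(n)}(T^{-n}x)$). Then: 1. $\mathcal T^f$ is weakly mixing: if $s\in\mathbb R$ and $F\in L^2(X^f,\mu^f;\mathbb C)$ satisfy, for every $t\in\mathbb R$, $F\circ T^f_t=e^{2\pi i st}F$ $\mu^f$-a.e., then $F$ is $\mu^f$-a.e. constant. 2. $\mathcal T^f$ has the cocycle Ratner property with the set $$P=(P'+[-\eta_0,\eta_0])\setminus\left(-\tfrac{\eta_0}4,\tfrac{\eta_0}4\right),$$ that is, $P$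 is a compact subset of $\mathbb R\setminus\{0\}$, and for every $\epsilon>0$ there is $\kappa>0$ such that for every $N\in\mathbb N$ there are $\delta>0$ and $Z\in\mathscr B$ with $\mu(Z)>1-\epsilon$ with the following property: if $x,x'\in Z$ and $0<d(x,x')<\delta$, then there are integers $M,L\ge N$ with $\frac LM\ge\kappa$ and $p\in P$ such that $$\frac1L\left|\{n\in\mathbb Z\cap[M,M+L]:\ |f^{(n)}(x)-f^{(n)}(x')-p|<\epsilon\}\right|>1-\epsilon .$$ -/

import Mathlib

open MeasureTheory
open scoped ENNReal Pointwise

namespace SpecialFlow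

/-- The cocycle `f^{(n)}(x)`, `n ∈ ℤ`, generated by `f` over an invertible map `T`:
`f^{(n)}(x) = f(x) + f(Tx) + ... + f(T^{n-1}x)` for `n ≥ 0` and
`f^{(-n)}(x) = -f^{(n)}(T^{-n}x)`. -/
def cocycle {X : Type*} (T : Equiv.Perm X) (f : X → ℝ) : ℤ → X → ℝ
  | Int.ofNat n, x => birkhoffSum T f n x
  | Int.negSucc n, x => -birkhoffSum T f (n + 1) ((T ^ Int.negSucc n) x)

theorem cocycle_natCast {X : Type*} (T : Equiv.Perm X) (f : X → ℝ) (n : ℕ) (x : X) :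
    cocycle T f (n : ℤ) x = birkhoffSum T f n x := rfl

theorem cocycle_add_one {X : Type*} (T : Equiv.Perm X) (f : X → ℝ) (n : ℤ) (x : X) :
    cocycle T f (n + 1) x = cocycle T f n x + f ((T ^ n) x) := by
  rcases n with n | n
  · change birkhoffSum T f (n + 1) x = birkhoffSum T f n x + f ((T ^ (n : ℤ)) x)
    rw [birkhoffSum_succ, zpow_natCast, Equiv.Perm.coe_pow]
  · have h2 : T ((T ^ Int.negSucc n) x) = (T ^ (Int.negSucc n + 1)) x := by
      rw [add_comm, zpow_add, zpow_one, Equiv.Perm.mul_apply]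
    have h1 : cocycle T f (Int.negSucc n + 1) x
        = -birkhoffSum T f n ((T ^ (Int.negSucc n + 1)) x) := by
      rcases n with _ | n
      · change birkhoffSum T f 0 x = -birkhoffSum T f 0 _
        simp
      · rfl
    rw [h1, ← h2]
    change _ = -birkhoffSum T f (n + 1) _ + _
    rw [birkhoffSum_succ']
    ring

/-- The phase space `X^f = {(x, s) : 0 ≤ s < f x}`. -/
def space {X : Type*} (f : X → ℝ) : Set (X × ℝ) :=
  {z | 0 ≤ z.2 ∧ z.2 < f z.1}

/-- The measure `μ^f`: the restriction of `μ ⊗ Lebesgue` to `X^f`. -/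
noncomputable def measure {X : Type*} [MeasurableSpace X] (μ : Measure X) (f : X → ℝ) :
    Measure (X × ℝ) :=
  (μ.prod volume).restrict (space f)

/-- The integer `n` with `f^{(n)}(x) ≤ u < f^{(n+1)}(x)`. It exists and is unique as soon as `f`
is bounded below by a positive constant along the orbit of `x`
(see `existsUnique_crossing`). -/
noncomputable def crossing {X : Type*} (T : Equiv.Perm X) (f : X → ℝ) (x : X) (u : ℝ) : ℤ :=
  Classical.epsilon fun n : ℤ => cocycle T f n x ≤ u ∧ u < cocycle T f (n + 1) x

theorem existsUnique_crossing {X : Type*} (T : Equiv.Perm X) (f : X → ℝ) (x : X) {c : ℝ}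
    (hc : 0 < c) (hf : ∀ k : ℤ, c ≤ f ((T ^ k) x)) (u : ℝ) :
    ∃! n : ℤ, cocycle T f n x ≤ u ∧ u < cocycle T f (n + 1) x := by
  have step : ∀ n : ℤ, cocycle T f n x + c ≤ cocycle T f (n + 1) x := fun n => by
    rw [cocycle_add_one]; linarith [hf n]
  have gap : ∀ (n : ℤ) (k : ℕ), cocycle T f n x + k * c ≤ cocycle T f (n + k) x := by
    intro n k
    induction k with
    | zero => simp
    | succ k ih =>
      have := step (n + k)
      push_cast
      rw [← add_assoc]
      linarith
  have mono : ∀ m n : ℤ, m ≤ n → cocycle T f m x ≤ cocycle T f n x := by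
    intro m n h
    obtain ⟨k, rfl⟩ := Int.le.dest h
    have := gap m k
    have : 0 ≤ (k : ℝ) * c := by positivity
    linarith
  have zero : cocycle T f 0 x = 0 := by
    change birkhoffSum T f 0 x = 0
    simp
  obtain ⟨K, hK⟩ := exists_nat_gt (|u| / c)
  rw [div_lt_iff₀ hc] at hK
  have up : u < cocycle T f K x := by
    have := gap 0 K
    rw [zero, zero_add, zero_add] at this
    linarith [le_abs_self u]
  have low : cocycle T f (-K) x ≤ u := by
    have := gap (-K) K
    rw [neg_add_cancel, zero] at this
    linarith [neg_abs_le u]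
  obtain ⟨n, hn, hmax⟩ := Int.exists_greatest_of_bdd
    (P := fun n : ℤ => cocycle T f n x ≤ u)
    ⟨K, fun z hz => by
      by_contra! h
      exact absurd (mono _ _ h.le) (not_le.2 (lt_of_le_of_lt hz up))⟩ ⟨-K, low⟩
  refine ⟨n, ⟨hn, ?_⟩, ?_⟩
  · by_contra! h
    have := hmax _ h
    omega
  · rintro m ⟨hm1, hm2⟩
    refine le_antisymm (hmax _ hm1) ?_
    by_contra! h
    exact absurd (mono (m + 1) n h) (not_le.2 (lt_of_le_of_lt hn hm2))

/-- The special flow `T^f_t(x, s) = (T^n x, s + t - f^{(n)}(x))`, where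
`f^{(n)}(x) ≤ s + t < f^{(n+1)}(x)`. It acts on `X^f`; its values outside `X^f` are never used,
since the measure `measure μ f` is carried by `X^f`. -/
noncomputable def flow {X : Type*} (T : Equiv.Perm X) (f : X → ℝ) (t : ℝ) (z : X × ℝ) : X × ℝ :=
  let n := crossing T f z.1 (z.2 + t)
  ((T ^ n) z.1, z.2 + t - cocycle T f n z.1)

end SpecialFlow

/-- Weak mixing of a flow `(S_t)` on `(Ω, ν)`: every square-integrable eigenfunction of the
flow is constant almost everywhere. (The case `s = 0` is ergodicity.) -/
def IsWeaklyMixingFlow {Ω : Type*} [MeasurableSpace Ω] (S : ℝ → Ω → Ω) (ν : Measure Ω) : Prop :=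
  ∀ (s : ℝ) (F : Ω → ℂ), MemLp F 2 ν →
    (∀ t : ℝ, ∀ᵐ z ∂ν, F (S t z) = Complex.exp (2 * Real.pi * s * t * Complex.I) * F z) →
    ∃ a : ℂ, ∀ᵐ z ∂ν, F z = a

/-- Almost every point is not periodic. -/
def IsAperiodic {X : Type*} [MeasurableSpace X] (T : X → X) (μ : Measure X) : Prop :=
  ∀ n : ℕ, 0 < n → ∀ᵐ x ∂μ, T^[n] x ≠ x

/-- The integers `n ∈ [M, M + L]` with `|f^{(n)}(x) - f^{(n)}(x') - p| < ε`. -/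
def driftTimes {X : Type*} (T : X → X) (f : X → ℝ) (x x' : X) (p ε : ℝ) (M L : ℕ) : Set ℕ :=
  {n | M ≤ n ∧ n ≤ M + L ∧ |birkhoffSum T f n x - birkhoffSum T f n x' - p| < ε}

/-- The cocycle Ratner property, with the compact set `P ⊆ ℝ \ {0}`, of the special flow given
by `T` and `f`. The constant `κ` depends on `ε` only; `δ` and `Z` depend on `ε` and `N`. -/
def HasCocycleRatnerProperty {X : Type*} [MetricSpace X] [MeasurableSpace X]
    (T : X → X) (μ : Measure X) (f : X → ℝ) (P : Set ℝ) : Prop :=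
  IsCompact P ∧ (0 : ℝ) ∉ P ∧
  ∀ ε : ℝ, 0 < ε → ∃ κ : ℝ, 0 < κ ∧ ∀ N : ℕ,
    ∃ δ : ℝ, 0 < δ ∧ ∃ Z : Set X, MeasurableSet Z ∧ 1 - ε < μ.real Z ∧
      ∀ x ∈ Z, ∀ x' ∈ Z, 0 < dist x x' → dist x x' < δ →
        ∃ M L : ℕ, N ≤ M ∧ N ≤ L ∧ κ ≤ (L : ℝ) / M ∧
          ∃ p ∈ P, 1 - ε < ((driftTimes T f x x' p ε M L).ncard : ℝ) / L

/-!
Let `χ(t) = e^{2πist}` be the eigenvalue character of an eigenfunction `F` of the special flow.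
Following the flow inside a fibre shows `F(x, u) = χ(u) g(x)`, and crossing the roof once shows
`g ∘ T = χ(f) g`. By ergodicity `|g|` is constant, so either `F = 0` or `g` may be taken
unimodular.

In the latter case, approximate `g` in `L¹` by a continuous `φ`. By the maximal ergodic theorem the
Birkhoff averages of `|g - φ|` are uniformly small at most points, and since `T` is an isometry,
`φ(T^n x)` and `φ(T^n x')` stay close for every `n` when `x` and `x'` are close. As
`f^{(n)}(x) - f^{(n)}(x') ≈ p` for most `n` in a window `[M, M + L]` with `L ≥ κ M`, some such `n`
has `g(T^n x) ≈ g(T^n x')`, and the equation for `g` gives `χ(p) ≈ 1`. In the same way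
`χ(p + η) ≈ 1`, so `χ(η) = 1` for all small `η`. Hence `χ = 1` and `g` is `T`-invariant, so
constant.
-/

section MaximalErgodicTheorem

variable {α : Type*} {T : α → α}

theorem partialSups_birkhoffSum_nonneg {R : Type*} [AddCommMonoid R] [SemilatticeSup R]
    (u : α → R) (N : ℕ) (x : α) : 0 ≤ partialSups (birkhoffSum T u) N x := by
  simpa using le_partialSups_of_le (birkhoffSum T u) N.zero_le x

theorem partialSups_birkhoffSum_le_of_pos {R : Type*} [AddCommMonoid R] [LinearOrder R]
    [IsOrderedAddMonoid R] {u : α → R} {N : ℕ} {x : α}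
    (hpos : 0 < partialSups (birkhoffSum T u) N x) :
    partialSups (birkhoffSum T u) N x ≤ u x + partialSups (birkhoffSum T u) N (T x) := by
  rw [Pi.partialSups_apply] at hpos ⊢
  obtain ⟨n, hnN, hn⟩ := exists_partialSups_eq (birkhoffSum T u · x) N
  rw [hn] at hpos ⊢
  obtain _ | n := n
  · simp at hpos
  · rw [birkhoffSum_succ']
    gcongr
    exact le_partialSups_of_le (birkhoffSum T u) (Nat.le_of_succ_le hnN) (T x)

variable [MeasurableSpace α] {μ : Measure α} {u : α → ℝ}

theorem integrable_birkhoffSum {E : Type*} [NormedAddCommGroup E] {u : α → E}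
    (hT : MeasurePreserving T μ μ) (hu : Integrable u μ) (n : ℕ) :
    Integrable (birkhoffSum T u n) μ :=
  integrable_finsetSum _ fun k _ => (hT.iterate k).integrable_comp_of_integrable hu

theorem integrable_partialSups_birkhoffSum (hT : MeasurePreserving T μ μ) (hu : Integrable u μ)
    (N : ℕ) : Integrable (partialSups (birkhoffSum T u) N) μ := by
  induction N with
  | zero => simp
  | succ N ih =>
    rw [partialSups_add_one]
    exact ih.sup (integrable_birkhoffSum hT hu (N + 1))

theorem setIntegral_nonneg_of_pos_partialSups_birkhoffSum (hT : MeasurePreserving T μ μ)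
    (hu : Integrable u μ) (N : ℕ) :
    0 ≤ ∫ x in {x | 0 < partialSups (birkhoffSum T u) N x}, u x ∂μ := by
  set m := partialSups (birkhoffSum T u) N
  set A := {x | 0 < m x}
  have hm : Integrable m μ := integrable_partialSups_birkhoffSum hT hu N
  have hmT : Integrable (m ∘ T) μ := hT.integrable_comp_of_integrable hm
  have hm_nonneg : 0 ≤ m := partialSups_birkhoffSum_nonneg u N
  have hA : NullMeasurableSet A μ := nullMeasurableSet_lt aemeasurable_const hm.aemeasurable
  have hmA : ∫ x in A, m x ∂μ = ∫ x, m x ∂μ :=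
    setIntegral_eq_integral_of_forall_compl_eq_zero fun x hx =>
      (hm_nonneg x).antisymm' (not_lt.1 hx)
  have hmTA : ∫ x in A, m (T x) ∂μ ≤ ∫ x, m x ∂μ :=
    calc ∫ x in A, m (T x) ∂μ ≤ ∫ x, m (T x) ∂μ :=
          setIntegral_le_integral hmT (ae_of_all _ fun x => hm_nonneg (T x))
      _ = ∫ x, m x ∂μ := by
          conv_rhs => rw [← hT.map_eq]
          exact (integral_map hT.aemeasurable (hT.map_eq.symm ▸ hm.aestronglyMeasurable)).symm
  calc 0 ≤ ∫ x in A, m x ∂μ - ∫ x in A, m (T x) ∂μ := by rw [hmA]; exact sub_nonneg.2 hmTA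
    _ = ∫ x in A, (m x - m (T x)) ∂μ := (integral_sub hm.integrableOn hmT.integrableOn).symm
    _ ≤ ∫ x in A, u x ∂μ :=
        setIntegral_mono_on₀ (hm.sub hmT).integrableOn hu.integrableOn hA fun x hx =>
          sub_le_iff_le_add.2 (partialSups_birkhoffSum_le_of_pos hx)

theorem mul_measureReal_exists_lt_birkhoffSum_le [IsFiniteMeasure μ]
    (hT : MeasurePreserving T μ μ) (hu : Integrable u μ) (hu_nonneg : 0 ≤ u) (r : ℝ) :
    r * μ.real {x | ∃ n : ℕ, r * n < birkhoffSum T u n x} ≤ ∫ x, u x ∂μ := by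
  set v : α → ℝ := fun x => u x - r with hv_def
  have hv : Integrable v μ := hu.sub (integrable_const r)
  set A : ℕ → Set α := fun N => {x | 0 < partialSups (birkhoffSum T v) N x} with hA_def
  have hsum (n : ℕ) (x : α) : birkhoffSum T v n x = birkhoffSum T u n x - r * n := by
    simp [birkhoffSum, hv_def, mul_comm]
  have hA_iUnion : {x | ∃ n : ℕ, r * n < birkhoffSum T u n x} = ⋃ N, A N := by
    ext x
    simp only [Set.mem_ofPred_eq, Set.mem_iUnion, hA_def]
    constructor
    · rintro ⟨n, hn⟩
      exact ⟨n, (sub_pos.2 hn).trans_le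
        ((hsum n x).ge.trans (le_partialSups (birkhoffSum T v) n x))⟩
    · rintro ⟨N, hN⟩
      rw [Pi.partialSups_apply] at hN
      obtain ⟨n, -, hn⟩ := exists_partialSups_eq (birkhoffSum T v · x) N
      exact ⟨n, sub_pos.1 (hsum n x ▸ hn ▸ hN)⟩
  have hA_mono : Monotone A := fun N N' hN x hx =>
    lt_of_lt_of_le hx (partialSups_monotone (birkhoffSum T v) hN x)
  have hA_le (N : ℕ) : r * μ.real (A N) ≤ ∫ x, u x ∂μ := by
    have hint := setIntegral_nonneg_of_pos_partialSups_birkhoffSum hT hv N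
    rw [integral_sub hu.integrableOn (integrable_const r).integrableOn, setIntegral_const,
      smul_eq_mul, sub_nonneg, mul_comm] at hint
    exact hint.trans (setIntegral_le_integral hu (ae_of_all _ hu_nonneg))
  rw [hA_iUnion]
  have hlim := (ENNReal.tendsto_toReal (measure_ne_top μ _)).comp
    (tendsto_measure_iUnion_atTop hA_mono)
  exact le_of_tendsto (hlim.const_mul r) (.of_forall hA_le)

end MaximalErgodicTheorem

section ClosePairs

variable {X : Type*} [MeasurableSpace X] {μ : Measure X}

theorem nullSingletonClass_of_isAperiodic [MeasurableSingletonClass X] {T : X → X}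
    (hT : Conservative T μ) (hap : IsAperiodic T μ) : NullSingletonClass μ := by
  refine ⟨fun x => by_contra fun hx => ?_⟩
  obtain ⟨_, rfl, n, hn, hreturn⟩ :=
    hT.exists_mem_iterate_mem (measurableSet_singleton x).nullMeasurableSet hx
  refine hx (measure_mono_null ?_ (hap n (Nat.pos_of_ne_zero hn)))
  simpa using hreturn

theorem exists_ne_dist_lt_of_measure_ne_zero [PseudoMetricSpace X] [SecondCountableTopology X]
    [NullSingletonClass μ] {A : Set X} (hA : μ A ≠ 0) {δ : ℝ} (hδ : 0 < δ) :
    ∃ x ∈ A, ∃ x' ∈ A, x ≠ x' ∧ dist x x' < δ := by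
  obtain ⟨x, hxA, hx⟩ := exists_mem_forall_mem_nhdsWithin_pos_measure hA
  have hball : 0 < μ (Metric.ball x δ ∩ A) := hx _ (Filter.inter_mem
    (mem_nhdsWithin_of_mem_nhds (Metric.ball_mem_nhds x hδ)) self_mem_nhdsWithin)
  obtain ⟨x', ⟨hx'δ, hx'A⟩, hne⟩ : ∃ x' ∈ Metric.ball x δ ∩ A, x' ≠ x := by
    by_contra! hsub
    exact hball.ne' (measure_mono_null hsub (measure_singleton x))
  exact ⟨x, hxA, x', hx'A, hne.symm, Metric.mem_ball'.1 hx'δ⟩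

theorem isometry_iterate {Y : Type*} [PseudoEMetricSpace Y] {T : Y → Y} (hT : Isometry T) (n : ℕ) :
    Isometry T^[n] := by
  induction n with
  | zero => exact isometry_id
  | succ n ih => exact ih.comp hT

end ClosePairs

/-- Nearby points of a set of measure almost one see the Birkhoff sums of `f` drift apart by some
`p ∈ P'`, and also by `p + η`, during almost all of two time windows `[M, M + L]` whose lengths
are bounded below by a multiple of their starting times. This is the hypothesis of the theorem at
a single `η`. -/
def HasDoubleDrift {X : Type*} [MetricSpace X] [MeasurableSpace X] (T : X → X) (μ : Measure X)
    (f : X → ℝ) (P' : Set ℝ) (η : ℝ) : Prop :=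
  ∀ ε : ℝ, 0 < ε → ∃ κ : ℝ, 0 < κ ∧ ∀ N : ℕ,
    ∃ δ : ℝ, 0 < δ ∧ ∃ Z' : Set X, MeasurableSet Z' ∧ 1 - ε < μ.real Z' ∧
      ∀ x ∈ Z', ∀ x' ∈ Z', 0 < dist x x' → dist x x' < δ →
        ∃ M₁ M₂ L₁ L₂ : ℕ, N ≤ M₁ ∧ N ≤ M₂ ∧ N ≤ L₁ ∧ N ≤ L₂ ∧
          κ ≤ (L₁ : ℝ) / M₁ ∧ κ ≤ (L₂ : ℝ) / M₂ ∧
          ∃ p ∈ P',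
            1 - ε < ((driftTimes T f x x' p ε M₁ L₁).ncard : ℝ) / L₁ ∧
            1 - ε < ((driftTimes T f x x' (p + η) ε M₂ L₂).ncard : ℝ) / L₂

theorem hasCocycleRatnerProperty_of_hasDoubleDrift {X : Type*} [MetricSpace X]
    [MeasurableSpace X] {T : X → X} {μ : Measure X} {f : X → ℝ} {P' : Set ℝ} (hP' : IsCompact P')
    {η₀ : ℝ} (hη₀ : 0 < η₀) (h : HasDoubleDrift T μ f P' (η₀ / 2)) :
    HasCocycleRatnerProperty T μ f
      ((P' + Set.Icc (-η₀) η₀) \ Set.Ioo (-(η₀ / 4)) (η₀ / 4)) := by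
  refine ⟨(hP'.add isCompact_Icc).diff isOpen_Ioo, fun h0 => h0.2 ⟨by linarith, by linarith⟩, ?_⟩
  intro ε hε
  obtain ⟨κ, hκ, hdrift⟩ := h ε hε
  refine ⟨κ, hκ, fun N => ?_⟩
  obtain ⟨δ, hδ, Z, hZ, hZμ, hpairs⟩ := hdrift N
  refine ⟨δ, hδ, Z, hZ, hZμ, fun x hx x' hx' hne hlt => ?_⟩
  obtain ⟨M₁, M₂, L₁, L₂, hM₁, hM₂, hL₁, hL₂, hML₁, hML₂, p, hp, hp₁, hp₂⟩ :=
    hpairs x hx x' hx' hne hlt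
  -- A drift `p` too close to `0` is traded for the drift `p + η₀ / 2`.
  by_cases hp_small : p ∈ Set.Ioo (-(η₀ / 4)) (η₀ / 4)
  · refine ⟨M₂, L₂, hM₂, hL₂, hML₂, p + η₀ / 2,
      ⟨Set.add_mem_add hp ⟨by linarith, by linarith⟩, fun hmem => ?_⟩, hp₂⟩
    linarith [hp_small.1, hmem.2]
  · exact ⟨M₁, L₁, hM₁, hL₁, hML₁, p,
      ⟨⟨p, hp, 0, ⟨by linarith, hη₀.le⟩, add_zero p⟩, hp_small⟩, hp₁⟩

section AddChar

theorem addChar_eq_one_of_forall_Ioo {M : Type*} [Monoid M] {χ : AddChar ℝ M} {η₀ : ℝ}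
    (hη₀ : 0 < η₀) (h : ∀ η, 0 < η → η < η₀ → χ η = 1) : χ = 1 := by
  have hpos (t : ℝ) (ht : 0 < t) : χ t = 1 := by
    obtain ⟨n, hn⟩ := exists_nat_gt (t / η₀)
    have hn_pos : (0 : ℝ) < n := (div_pos ht hη₀).trans hn
    have hsmall : χ (t / n) = 1 := h _ (div_pos ht hn_pos) ((div_lt_comm₀ hη₀ hn_pos).1 hn)
    rw [← mul_div_cancel₀ t hn_pos.ne', ← nsmul_eq_mul, χ.map_nsmul_eq_pow, hsmall, one_pow]
  ext t
  obtain ht | rfl | ht := lt_trichotomy t 0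
  · have hmul := χ.map_add_eq_mul t (-t)
    rwa [add_neg_cancel, χ.map_zero_eq_one, hpos (-t) (neg_pos.2 ht), mul_one, eq_comm] at hmul
  · exact χ.map_zero_eq_one
  · exact hpos t ht

variable {A : Type*} [AddCommGroup A] {χ : AddChar A Circle}

theorem norm_addChar_sub (a b : A) : ‖(χ a : ℂ) - χ b‖ = ‖(χ (a - b) : ℂ) - 1‖ := by
  have hfactor : (χ a : ℂ) - χ b = (χ (a - b) - 1) * χ b := by
    rw [sub_mul, one_mul, ← Circle.coe_mul, ← χ.map_add_eq_mul, sub_add_cancel]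
  rw [hfactor, norm_mul, Circle.norm_coe, mul_one]

theorem norm_addChar_sub_one_le {a a' : A} {w w' z z' : ℂ} (hw : w = χ a * z)
    (hw' : w' = χ a' * z') (hz' : ‖z'‖ = 1) :
    ‖(χ (a - a') : ℂ) - 1‖ ≤ ‖w - w'‖ + ‖z - z'‖ :=
  calc ‖(χ (a - a') : ℂ) - 1‖ = ‖((χ a : ℂ) - χ a') * z'‖ := by
        rw [norm_mul, hz', mul_one, norm_addChar_sub]
    _ = ‖(w - w') - χ a * (z - z')‖ := by rw [hw, hw']; ring_nf
    _ ≤ ‖w - w'‖ + ‖χ a * (z - z')‖ := norm_sub_le _ _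
    _ = ‖w - w'‖ + ‖z - z'‖ := by rw [norm_mul, Circle.norm_coe, one_mul]

end AddChar

section DriftTimes

variable {X : Type*} {T : X → X} {f w : X → ℝ}

theorem exists_mem_card_mul_apply_iterate_le (hw : 0 ≤ w) {D : Finset ℕ} (hD : D.Nonempty) {K : ℕ}
    (hDK : D ⊆ Finset.range K) (x x' : X) :
    ∃ n ∈ D, D.card * (w (T^[n] x) + w (T^[n] x')) ≤
      birkhoffSum T w K x + birkhoffSum T w K x' := by
  have hsum : ∑ n ∈ D, (w (T^[n] x) + w (T^[n] x')) ≤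
      birkhoffSum T w K x + birkhoffSum T w K x' := by
    rw [birkhoffSum, birkhoffSum, ← Finset.sum_add_distrib]
    exact Finset.sum_le_sum_of_subset_of_nonneg hDK fun n _ _ => add_nonneg (hw _) (hw _)
  obtain ⟨n, hn, hle⟩ := Finset.exists_min_image D (fun n => w (T^[n] x) + w (T^[n] x')) hD
  exact ⟨n, hn, ((nsmul_eq_mul _ _).symm.trans_le (D.card_nsmul_le_sum _ _ hle)).trans hsum⟩

theorem exists_mem_driftTimes_apply_iterate_le (hw : 0 ≤ w) {x x' : X} {r : ℝ}
    (hx : ∀ n : ℕ, birkhoffSum T w n x ≤ r * n) (hx' : ∀ n : ℕ, birkhoffSum T w n x' ≤ r * n)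
    {p ε κ : ℝ} {M L : ℕ} (hM : 1 ≤ M) (hL : 1 ≤ L) (hκ : 0 < κ) (hML : κ ≤ (L : ℝ) / M)
    (hε : ε ≤ 1 / 2) (hp : 1 - ε < ((driftTimes T f x x' p ε M L).ncard : ℝ) / L) :
    ∃ n ∈ driftTimes T f x x' p ε M L,
      w (T^[n] x) + w (T^[n] x') ≤ 4 * r * (1 / κ + 2) := by
  have hM_pos : (0 : ℝ) < M := by exact_mod_cast hM
  have hL_one : (1 : ℝ) ≤ L := by exact_mod_cast hL
  have hr : 0 ≤ r := by simpa using (hw x).trans (by simpa using hx 1)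
  have hsub : driftTimes T f x x' p ε M L ⊆ Finset.range (M + L + 1) := fun n hn => by
    simpa using Nat.lt_succ_of_le hn.2.1
  lift driftTimes T f x x' p ε M L to Finset ℕ using Finset.finite_toSet _ |>.subset hsub
    with D hD
  rw [Set.ncard_coe_finset, lt_div_iff₀ (by positivity)] at hp
  have hcard : (L : ℝ) / 2 ≤ D.card := by nlinarith
  have hD_pos : (0 : ℝ) < D.card := by linarith
  obtain ⟨n, hn, hle⟩ := exists_mem_card_mul_apply_iterate_le (T := T) hw
    (Finset.card_pos.1 (by exact_mod_cast hD_pos)) (Finset.coe_subset.1 hsub) x x'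
  refine ⟨n, hn, le_of_mul_le_mul_left ?_ hD_pos⟩
  have hK : ((M + L + 1 : ℕ) : ℝ) ≤ L * (1 / κ + 2) := by
    have hM_le : (M : ℝ) ≤ L * (1 / κ) := by
      rw [mul_one_div, le_div_iff₀' hκ]
      exact (le_div_iff₀ hM_pos).1 hML
    push_cast
    linarith
  calc D.card * (w (T^[n] x) + w (T^[n] x'))
      ≤ r * (M + L + 1 : ℕ) + r * (M + L + 1 : ℕ) := hle.trans (add_le_add (hx _) (hx' _))
    _ = 2 * r * (M + L + 1 : ℕ) := by ring
    _ ≤ 2 * r * (L * (1 / κ + 2)) := by gcongr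
    _ = L / 2 * (4 * r * (1 / κ + 2)) := by ring
    _ ≤ D.card * (4 * r * (1 / κ + 2)) := by gcongr

end DriftTimes

section CohomologicalEquation

variable {X : Type*} {T : X → X} {f : X → ℝ} {χ : AddChar ℝ Circle} {g : X → ℂ}

theorem ae_forall_apply_iterate_eq_of_ae_apply_eq [MeasurableSpace X] {μ : Measure X}
    (hT : Measure.QuasiMeasurePreserving T μ μ) (hg : ∀ᵐ x ∂μ, g (T x) = χ (f x) * g x) :
    ∀ᵐ x ∂μ, ∀ n : ℕ, g (T^[n] x) = χ (birkhoffSum T f n x) * g x := by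
  have horbit : ∀ᵐ x ∂μ, ∀ n : ℕ, g (T (T^[n] x)) = χ (f (T^[n] x)) * g (T^[n] x) :=
    ae_all_iff.2 fun n => (hT.iterate n).ae hg
  filter_upwards [horbit] with x hx n
  induction n with
  | zero => simp
  | succ n ih =>
    rw [Function.iterate_succ_apply', hx n, ih, birkhoffSum_succ, χ.map_add_eq_mul,
      Circle.coe_mul, mul_left_comm, mul_assoc]

theorem ae_eq_zero_or_exists_unimodular [MeasurableSpace X] {μ : Measure X} (hT : Ergodic T μ)
    (hg : Measurable g) (hgT : ∀ᵐ x ∂μ, g (T x) = χ (f x) * g x) :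
    g =ᵐ[μ] 0 ∨ ∃ g' : X → ℂ, Measurable g' ∧ (∀ᵐ x ∂μ, ‖g' x‖ = 1) ∧
      ∀ᵐ x ∂μ, g' (T x) = χ (f x) * g' x := by
  obtain ⟨r, hr⟩ : ∃ r : ℝ, (fun x => ‖g x‖) =ᵐ[μ] Function.const X r := by
    refine hT.ae_eq_const_of_ae_eq_comp_ae hg.norm.aestronglyMeasurable ?_
    filter_upwards [hgT] with x hx
    rw [Function.comp_apply, hx, norm_mul, Circle.norm_coe, one_mul]
  obtain rfl | hr0 := eq_or_ne r 0
  · exact .inl (hr.mono fun x hx => norm_eq_zero.1 hx)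
  · refine .inr ⟨fun x => g x / ‖g x‖, hg.div (Complex.measurable_ofReal.comp hg.norm), ?_, ?_⟩
    · filter_upwards [hr] with x hx
      have : ‖g x‖ ≠ 0 := fun h0 => hr0 (hx.symm.trans h0)
      simp [this]
    · filter_upwards [hgT] with x hx
      rw [hx, norm_mul, Circle.norm_coe, one_mul, mul_div_assoc]

/-- A point at which a unimodular solution `g` of `g ∘ T = χ(f) g` behaves well: `|g| = 1`, the
equation holds along the whole orbit, and along each initial piece of the orbit the approximation
`φ` of `g` is within `r` of `g` on average. -/
structure IsRegularPoint (T : X → X) (f : X → ℝ) (χ : AddChar ℝ Circle) (g φ : X → ℂ) (r : ℝ)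
    (x : X) : Prop where
  norm_apply_eq_one : ‖g x‖ = 1
  apply_iterate_eq (n : ℕ) : g (T^[n] x) = χ (birkhoffSum T f n x) * g x
  birkhoffSum_le (n : ℕ) : birkhoffSum T (fun y => ‖g y - φ y‖) n x ≤ r * n

theorem IsRegularPoint.norm_apply_sub_le {φ : X → ℂ} {r : ℝ} {x : X}
    (hx : IsRegularPoint T f χ g φ r x) : ‖g x - φ x‖ ≤ r := by
  simpa using hx.birkhoffSum_le 1

theorem IsRegularPoint.norm_addChar_drift_sub_one_le {φ : X → ℂ} {r : ℝ} {x x' : X}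
    (hx : IsRegularPoint T f χ g φ r x) (hx' : IsRegularPoint T f χ g φ r x') {τ : ℝ}
    (hφ : ∀ n : ℕ, ‖φ (T^[n] x) - φ (T^[n] x')‖ ≤ τ) {ε : ℝ} (hε : ε ≤ 1 / 2)
    (hχ : ∀ t : ℝ, |t| < ε → ‖(χ t : ℂ) - 1‖ ≤ τ) {κ : ℝ} (hκ : 0 < κ)
    (hr : 4 * r * (1 / κ + 2) ≤ τ) {p : ℝ} {M L : ℕ} (hM : 1 ≤ M) (hL : 1 ≤ L)
    (hML : κ ≤ (L : ℝ) / M) (hp : 1 - ε < ((driftTimes T f x x' p ε M L).ncard : ℝ) / L) :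
    ‖(χ p : ℂ) - 1‖ ≤ 5 * τ := by
  obtain ⟨n, hn, hclose⟩ := exists_mem_driftTimes_apply_iterate_le
    (w := fun y => ‖g y - φ y‖) (fun y => norm_nonneg _) hx.birkhoffSum_le hx'.birkhoffSum_le
    hM hL hκ hML hε hp
  have htriangle (y y' : X) :
      ‖g y - g y'‖ ≤ ‖g y - φ y‖ + ‖g y' - φ y'‖ + ‖φ y - φ y'‖ := by
    calc ‖g y - g y'‖ = ‖(g y - φ y) - (g y' - φ y') + (φ y - φ y')‖ := by ring_nf
      _ ≤ _ := (norm_add_le _ _).trans (add_le_add_left (norm_sub_le _ _) _)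
  have hr_small : 2 * r ≤ τ := by
    have hr_nonneg : 0 ≤ r := (norm_nonneg _).trans hx.norm_apply_sub_le
    have : 0 ≤ r * (1 / κ) := by positivity
    linarith
  have hstart : ‖g x - g x'‖ ≤ 2 * τ := by
    have hφ_start : ‖φ x - φ x'‖ ≤ τ := hφ 0
    linarith [htriangle x x', hx.norm_apply_sub_le, hx'.norm_apply_sub_le]
  have hend : ‖g (T^[n] x) - g (T^[n] x')‖ ≤ 2 * τ := by
    linarith [htriangle (T^[n] x) (T^[n] x'), hφ n]
  have hdiff := norm_addChar_sub_one_le (hx.apply_iterate_eq n) (hx'.apply_iterate_eq n)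
    hx'.norm_apply_eq_one
  set d := birkhoffSum T f n x - birkhoffSum T f n x'
  have hdrift : ‖(χ p : ℂ) - χ d‖ ≤ τ := by
    rw [norm_addChar_sub]
    exact hχ _ (abs_sub_comm p d ▸ hn.2.2)
  calc ‖(χ p : ℂ) - 1‖ ≤ ‖(χ p : ℂ) - χ d‖ + ‖(χ d : ℂ) - 1‖ := norm_sub_le_norm_sub_add_norm_sub ..
    _ ≤ 5 * τ := by linarith

theorem exists_boundedContinuous_measureReal_exists_lt_birkhoffSum_le [TopologicalSpace X]
    [NormalSpace X] [MeasurableSpace X] [BorelSpace X] {μ : Measure X} [IsFiniteMeasure μ]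
    [μ.WeaklyRegular] {E : Type*} [NormedAddCommGroup E] [NormedSpace ℝ E] {g : X → E}
    (hT : MeasurePreserving T μ μ) (hg : Integrable g μ) {r ρ : ℝ} (hr : 0 < r) (hρ : 0 < ρ) :
    ∃ φ : BoundedContinuousFunction X E,
      μ.real {x | ∃ n : ℕ, r * n < birkhoffSum T (fun y => ‖g y - φ y‖) n x} ≤ ρ := by
  obtain ⟨φ, hφ, hφi⟩ := hg.exists_boundedContinuous_integral_sub_le (mul_pos hr hρ)
  exact ⟨φ, le_of_mul_le_mul_left ((mul_measureReal_exists_lt_birkhoffSum_le hT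
    (hg.sub hφi).norm (fun x => norm_nonneg _) r).trans hφ) hr⟩

theorem exists_boundedContinuous_measure_isRegularPoint_ne_zero [TopologicalSpace X]
    [NormalSpace X] [MeasurableSpace X] [BorelSpace X] {μ : Measure X} [IsFiniteMeasure μ]
    [μ.WeaklyRegular] (hT : MeasurePreserving T μ μ) (hg : Measurable g)
    (hg_norm : ∀ᵐ x ∂μ, ‖g x‖ = 1) (hgT : ∀ᵐ x ∂μ, g (T x) = χ (f x) * g x) {r : ℝ} (hr : 0 < r)
    {A : Set X} (hA : μ A ≠ 0) :
    ∃ φ : BoundedContinuousFunction X ℂ, μ {x ∈ A | IsRegularPoint T f χ g φ r x} ≠ 0 := by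
  have hA_pos : 0 < μ.real A := ENNReal.toReal_pos hA (measure_ne_top μ A)
  have hgi : Integrable g μ :=
    .of_bound hg.aestronglyMeasurable 1 (hg_norm.mono fun x hx => hx.le)
  obtain ⟨φ, hφ⟩ := exists_boundedContinuous_measureReal_exists_lt_birkhoffSum_le hT hgi hr
    (half_pos hA_pos)
  refine ⟨φ, fun hnull => ?_⟩
  have hA_le : A ≤ᵐ[μ] {x | ∃ n : ℕ, r * n < birkhoffSum T (fun y => ‖g y - φ y‖) n x} := by
    filter_upwards [measure_eq_zero_iff_ae_notMem.1 hnull, hg_norm,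
      ae_forall_apply_iterate_eq_of_ae_apply_eq hT.quasiMeasurePreserving hgT]
      with x hx hx_norm hx_orbit hxA
    by_contra! hx_le
    exact hx ⟨hxA, hx_norm, hx_orbit, fun n => not_lt.1 fun hn => hx_le ⟨n, hn⟩⟩
  have := (ENNReal.toReal_mono (measure_ne_top μ _) (measure_mono_ae hA_le)).trans hφ
  rw [← measureReal_def] at this
  linarith

variable [MetricSpace X] [CompactSpace X] [MeasurableSpace X] [BorelSpace X] {μ : Measure X}
  [IsProbabilityMeasure μ]

theorem exists_isRegularPoint_pair (hT : Isometry T) (hTμ : MeasurePreserving T μ μ)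
    (hap : IsAperiodic T μ) (hg : Measurable g) (hg_norm : ∀ᵐ x ∂μ, ‖g x‖ = 1)
    (hgT : ∀ᵐ x ∂μ, g (T x) = χ (f x) * g x) {A : Set X} (hA : μ A ≠ 0) {r τ δ : ℝ} (hr : 0 < r)
    (hτ : 0 < τ) (hδ : 0 < δ) :
    ∃ φ : X → ℂ, ∃ x ∈ A, ∃ x' ∈ A, x ≠ x' ∧ dist x x' < δ ∧
      IsRegularPoint T f χ g φ r x ∧ IsRegularPoint T f χ g φ r x' ∧
      ∀ n : ℕ, ‖φ (T^[n] x) - φ (T^[n] x')‖ ≤ τ := by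
  have := nullSingletonClass_of_isAperiodic hTμ.conservative hap
  obtain ⟨φ, hφ⟩ :=
    exists_boundedContinuous_measure_isRegularPoint_ne_zero hTμ hg hg_norm hgT hr hA
  obtain ⟨δ', hδ', hφδ'⟩ := Metric.uniformContinuous_iff.1
    (CompactSpace.uniformContinuous_of_continuous φ.continuous) τ hτ
  obtain ⟨x, ⟨hxA, hx⟩, x', ⟨hxA', hx'⟩, hne, hlt⟩ :=
    exists_ne_dist_lt_of_measure_ne_zero hφ (lt_min hδ hδ')
  refine ⟨φ, x, hxA, x', hxA', hne, hlt.trans_le (min_le_left _ _), hx, hx', fun n => ?_⟩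
  rw [← dist_eq_norm]
  exact (hφδ' ((isometry_iterate hT n).dist_eq x x' ▸ hlt.trans_le (min_le_right _ _))).le

theorem norm_addChar_sub_one_le_of_hasDoubleDrift (hT : Isometry T) (hTμ : MeasurePreserving T μ μ)
    (hap : IsAperiodic T μ) {P' : Set ℝ} {η : ℝ} (h : HasDoubleDrift T μ f P' η)
    (hχ : Continuous χ) (hg : Measurable g) (hg_norm : ∀ᵐ x ∂μ, ‖g x‖ = 1)
    (hgT : ∀ᵐ x ∂μ, g (T x) = χ (f x) * g x) {τ : ℝ} (hτ : 0 < τ) :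
    ‖(χ η : ℂ) - 1‖ ≤ 10 * τ := by
  have hχ_coe : Continuous fun t : ℝ => (χ t : ℂ) := continuous_subtype_val.comp hχ
  obtain ⟨ε₀, hε₀, hχε₀⟩ := Metric.continuousAt_iff.1 (hχ_coe.continuousAt (x := 0)) τ hτ
  set ε := min ε₀ (1 / 2)
  have hχε (t : ℝ) (ht : |t| < ε) : ‖(χ t : ℂ) - 1‖ ≤ τ := by
    simpa [dist_eq_norm] using (hχε₀ (x := t) (by simpa using ht.trans_le (min_le_left _ _))).le
  obtain ⟨κ, hκ, hdrift⟩ := h ε (by positivity)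
  obtain ⟨δ, hδ, Z, -, hZ, hpairs⟩ := hdrift 1
  have hZ_pos : 0 < μ.real Z := by linarith [min_le_right ε₀ (1 / 2)]
  set r := τ / (4 * (1 / κ + 2))
  have hrτ : 4 * r * (1 / κ + 2) ≤ τ := by
    rw [mul_right_comm, mul_div_cancel₀ _ (by positivity)]
  have hZ_ne : μ Z ≠ 0 := (measureReal_ne_zero_iff (measure_ne_top μ Z)).1 hZ_pos.ne'
  obtain ⟨φ, x, hxZ, x', hxZ', hne, hlt, hx, hx', hφ⟩ := exists_isRegularPoint_pair hT hTμ hap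
    hg hg_norm hgT hZ_ne (show 0 < r by positivity) hτ hδ
  obtain ⟨M₁, M₂, L₁, L₂, hM₁, hM₂, hL₁, hL₂, hML₁, hML₂, p, -, hp₁, hp₂⟩ :=
    hpairs x hxZ x' hxZ' (dist_pos.2 hne) hlt
  have hχp := hx.norm_addChar_drift_sub_one_le hx' hφ (min_le_right _ _) hχε hκ hrτ
    hM₁ hL₁ hML₁ hp₁
  have hχpη := hx.norm_addChar_drift_sub_one_le hx' hφ (min_le_right _ _) hχε hκ hrτ
    hM₂ hL₂ hML₂ hp₂
  calc ‖(χ η : ℂ) - 1‖ = ‖(χ (p + η) : ℂ) - χ p‖ := by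
        rw [norm_addChar_sub, add_sub_cancel_left]
    _ ≤ ‖(χ (p + η) : ℂ) - 1‖ + ‖1 - (χ p : ℂ)‖ := norm_sub_le_norm_sub_add_norm_sub ..
    _ ≤ 10 * τ := by rw [norm_sub_rev 1]; linarith

theorem addChar_eq_one_of_hasDoubleDrift (hT : Isometry T) (hTμ : MeasurePreserving T μ μ)
    (hap : IsAperiodic T μ) {P' : Set ℝ} {η : ℝ} (h : HasDoubleDrift T μ f P' η)
    (hχ : Continuous χ) (hg : Measurable g) (hg_norm : ∀ᵐ x ∂μ, ‖g x‖ = 1)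
    (hgT : ∀ᵐ x ∂μ, g (T x) = χ (f x) * g x) : χ η = 1 := by
  refine Circle.ext (sub_eq_zero.1 (norm_le_zero_iff.1 (le_of_forall_pos_le_add fun τ hτ => ?_)))
  have := norm_addChar_sub_one_le_of_hasDoubleDrift hT hTμ hap h hχ hg hg_norm hgT
    (show 0 < τ / 10 by positivity)
  rw [Circle.coe_one]
  linarith

end CohomologicalEquation

namespace SpecialFlow

section Cocycle

variable {X : Type*} {T : Equiv.Perm X} {f f' : X → ℝ} {c : ℝ} {x : X}

theorem cocycle_congr (h : ∀ k : ℤ, f ((T ^ k) x) = f' ((T ^ k) x)) (n : ℤ) :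
    cocycle T f n x = cocycle T f' n x := by
  have hsum (m : ℤ) (n : ℕ) :
      birkhoffSum T f n ((T ^ m) x) = birkhoffSum T f' n ((T ^ m) x) := by
    refine Finset.sum_congr rfl fun k _ => ?_
    rw [← Equiv.Perm.coe_pow, ← zpow_natCast, ← Equiv.Perm.mul_apply, ← zpow_add]
    exact h _
  obtain n | n := n
  · exact hsum 0 n
  · exact congrArg Neg.neg (hsum _ _)

theorem flow_congr {z : X × ℝ} (h : ∀ k : ℤ, f ((T ^ k) z.1) = f' ((T ^ k) z.1)) (t : ℝ) :
    flow T f t z = flow T f' t z := by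
  simp only [flow, crossing, cocycle_congr h]

theorem flow_eq_of_mem_space (hc : 0 < c) {z : X × ℝ} (hf : ∀ k : ℤ, c ≤ f ((T ^ k) z.1)) {t : ℝ}
    {n : ℤ} (h : ((T ^ n) z.1, z.2 + t - cocycle T f n z.1) ∈ space f) :
    flow T f t z = ((T ^ n) z.1, z.2 + t - cocycle T f n z.1) := by
  have hn : crossing T f z.1 (z.2 + t) = n := by
    have hunique := existsUnique_crossing T f z.1 hc hf (z.2 + t)
    refine hunique.unique (Classical.epsilon_spec hunique.exists) ⟨sub_nonneg.1 h.1, ?_⟩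
    rw [cocycle_add_one]
    exact sub_lt_iff_lt_add'.1 h.2
  simp only [flow, hn]

end Cocycle

section Measure

variable {X : Type*} [MeasurableSpace X] {μ : Measure X} {f f' : X → ℝ}

theorem measurableSet_space (hf : Measurable f) : MeasurableSet (space f) :=
  (measurableSet_le measurable_const measurable_snd).inter
    (measurableSet_lt measurable_snd (hf.comp measurable_fst))

theorem ae_measure_iff (hf : Measurable f) {p : X × ℝ → Prop} :
    (∀ᵐ z ∂measure μ f, p z) ↔ ∀ᵐ z ∂μ.prod volume, z ∈ space f → p z :=
  ae_restrict_iff' (measurableSet_space hf)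

instance [SFinite μ] : SFinite (measure μ f) :=
  inferInstanceAs (SFinite ((μ.prod volume).restrict (space f)))

theorem measure_congr (h : f =ᵐ[μ] f') : measure μ f = measure μ f' := by
  refine Measure.restrict_congr_set ?_
  filter_upwards [Measure.quasiMeasurePreserving_fst.ae h] with z hz
  exact congrArg (fun a => 0 ≤ z.2 ∧ z.2 < a) hz

theorem ae_measure_of_ae_fst {p : X → Prop} (hp : ∀ᵐ x ∂μ, p x) : ∀ᵐ z ∂measure μ f, p z.1 :=
  ae_restrict_of_ae (Measure.quasiMeasurePreserving_fst.ae hp)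

theorem ae_forall_zpow_apply {T : Equiv.Perm X} {p : X → Prop}
    (hT : Measure.QuasiMeasurePreserving T μ μ) (hT' : Measure.QuasiMeasurePreserving T.symm μ μ)
    (hp : ∀ᵐ x ∂μ, p x) : ∀ᵐ x ∂μ, ∀ k : ℤ, p ((T ^ k) x) := by
  refine ae_all_iff.2 fun k => ?_
  obtain ⟨n, rfl | rfl⟩ := k.eq_nat_or_neg
  · rw [zpow_natCast, Equiv.Perm.coe_pow]
    exact (hT.iterate n).ae hp
  · rw [zpow_neg, zpow_natCast, ← inv_pow, Equiv.Perm.coe_pow]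
    exact (hT'.iterate n).ae hp

theorem ae_of_ae_measure_fst (hf : Measurable f) (hf_pos : ∀ x, 0 < f x) {p : X → Prop}
    (hp : ∀ᵐ z ∂measure μ f, p z.1) : ∀ᵐ x ∂μ, p x := by
  filter_upwards [Measure.ae_ae_of_ae_prod ((ae_measure_iff hf).1 hp)] with x hx
  by_contra hpx
  have hnull : volume (Set.Ico 0 (f x)) = 0 :=
    measure_eq_zero_iff_ae_notMem.2 (hx.mono fun v hv hmem => hpx (hv hmem))
  simp [(hf_pos x).not_ge] at hnull

end Measure

section TransferFunction

variable {X : Type*} {χ : AddChar ℝ Circle} {f : X → ℝ} {F : X × ℝ → ℂ} {c : ℝ}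

/-- The function `F` with its expected dependence `χ(u)` on the height `u` divided out. If `F` is
an eigenfunction of the special flow, this does not depend on the height, and gives the solution
of the cohomological equation. -/
noncomputable def untwist (χ : AddChar ℝ Circle) (F : X × ℝ → ℂ) (z : X × ℝ) : ℂ :=
  χ (-z.2) * F z

theorem eq_mul_untwist (χ : AddChar ℝ Circle) (F : X × ℝ → ℂ) (z : X × ℝ) :
    F z = χ z.2 * untwist χ F z := by
  rw [untwist, ← mul_assoc, ← Circle.coe_mul, ← χ.map_add_eq_mul]
  simp

/-- The average of `untwist χ F` over the heights in `[0, c)`, a range present in every fibre as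
soon as `c` is a lower bound of the roof function. -/
noncomputable def transferFunction (χ : AddChar ℝ Circle) (F : X × ℝ → ℂ) (c : ℝ) (x : X) : ℂ :=
  ⨍ v in Set.Ico 0 c, untwist χ F (x, v)

theorem transferFunction_eq_of_ae_untwist_eq (hc : 0 < c) {x : X} (hcf : c ≤ f x) {a : ℂ}
    (h : ∀ᵐ v : ℝ, (x, v) ∈ space f → untwist χ F (x, v) = a) :
    transferFunction χ F c x = a := by
  have hconst : ∀ᵐ v : ℝ ∂volume.restrict (Set.Ico 0 c), untwist χ F (x, v) = a := by
    rw [ae_restrict_iff' measurableSet_Ico]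
    filter_upwards [h] with v hv hvc
    exact hv ⟨hvc.1, hvc.2.trans_le hcf⟩
  rw [transferFunction, setAverage_eq, integral_congr_ae hconst]
  simp [hc.le, hc.ne']

variable [MeasurableSpace X]

theorem measurable_untwist (hχ : Continuous χ) (hF : Measurable F) :
    Measurable (untwist χ F) :=
  ((continuous_subtype_val.comp hχ).measurable.comp measurable_snd.neg).mul hF

theorem measurable_transferFunction (hχ : Continuous χ) (hF : Measurable F) (c : ℝ) :
    Measurable (transferFunction χ F c) := by
  unfold transferFunction
  simp only [setAverage_eq]
  exact ((measurable_untwist hχ hF).stronglyMeasurable.integral_prod_right'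
    (ν := volume.restrict (Set.Ico 0 c))).measurable.const_smul _

variable {μ : Measure X} [SFinite μ]

theorem ae_untwist_eq_of_ae_apply_eq (hχ : Continuous χ) (hf : Measurable f) (hF : Measurable F)
    {S : X → X} (hS : Measurable S) {φ : X → ℝ} (hφ : Measurable φ)
    (h : ∀ t : ℝ, ∀ᵐ z ∂measure μ f, (S z.1, z.2 + t - φ z.1) ∈ space f →
      F (S z.1, z.2 + t - φ z.1) = χ t * F z) :
    ∀ᵐ z ∂measure μ f, ∀ᵐ v : ℝ, (S z.1, v) ∈ space f →
      untwist χ F (S z.1, v) = χ (φ z.1) * untwist χ F z := by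
  have hae : ∀ᵐ z ∂measure μ f, ∀ᵐ t : ℝ, (S z.1, z.2 + t - φ z.1) ∈ space f →
      F (S z.1, z.2 + t - φ z.1) = χ t * F z := by
    refine (Measure.ae_ae_comm ?_).1 (ae_of_all volume h)
    refine ((measurableSet_space hf).preimage (by fun_prop)).imp
      (measurableSet_eq_fun (by fun_prop) ?_)
    exact ((continuous_subtype_val.comp hχ).measurable.comp measurable_fst).mul
      (hF.comp measurable_snd)
  filter_upwards [hae] with z hz
  -- At height `v` above `S z.1` the flow arrives at time `t = v + φ z.1 - z.2`.
  filter_upwards [(measurePreserving_add_right volume (φ z.1 - z.2)).quasiMeasurePreserving.ae hz]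
    with v hv hmem
  have hheight : z.2 + (v + (φ z.1 - z.2)) - φ z.1 = v := by ring
  rw [hheight] at hv
  rw [untwist, untwist, hv hmem, ← mul_assoc, ← mul_assoc, ← Circle.coe_mul, ← Circle.coe_mul,
    ← χ.map_add_eq_mul, ← χ.map_add_eq_mul]
  congr 3
  ring

variable {T : Equiv.Perm X}

theorem ae_apply_sub_birkhoffSum_eq (hT : MeasurePreserving T μ μ) (hf : Measurable f)
    (hc : 0 < c) (hcf : ∀ x, c ≤ f x) {F' : X × ℝ → ℂ} (hF : F =ᵐ[measure μ f] F') {t : ℝ}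
    (hFt : ∀ᵐ z ∂measure μ f, F (flow T f t z) = χ t * F z) (n : ℕ) :
    ∀ᵐ z ∂measure μ f, (T^[n] z.1, z.2 + t - birkhoffSum T f n z.1) ∈ space f →
      F' (T^[n] z.1, z.2 + t - birkhoffSum T f n z.1) = χ t * F' z := by
  have hS : Measurable (birkhoffSum T f n) :=
    Finset.measurable_fun_sum _ fun k _ => hf.comp (hT.iterate k).measurable
  have hskew : MeasurePreserving (fun z : X × ℝ => (T^[n] z.1, z.2 + t - birkhoffSum T f n z.1))
      (μ.prod volume) (μ.prod volume) :=
    (hT.iterate n).skew_product (g := fun x u => u + t - birkhoffSum T f n x) (by fun_prop)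
      (ae_of_all _ fun x => by
        simpa only [add_sub_assoc] using
          (measurePreserving_add_right volume (t - birkhoffSum T f n x)).map_eq)
  filter_upwards [hF, hFt, ae_restrict_of_ae
    (hskew.quasiMeasurePreserving.ae ((ae_measure_iff hf).1 hF))] with z hz hzt hFz hmem
  have hflow : flow T f t z = (T^[n] z.1, z.2 + t - birkhoffSum T f n z.1) := by
    rw [← cocycle_natCast, ← Equiv.Perm.coe_pow, ← zpow_natCast] at hmem ⊢
    exact flow_eq_of_mem_space hc (fun k => hcf _) hmem
  rw [← hFz hmem, ← hflow, hzt, hz]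

theorem exists_measurable_cohomologicalEquation_of_le (hχ : Continuous χ)
    (hT : MeasurePreserving T μ μ) (hf : Measurable f) (hc : 0 < c) (hcf : ∀ x, c ≤ f x)
    (hF : AEMeasurable F (measure μ f))
    (hFt : ∀ t : ℝ, ∀ᵐ z ∂measure μ f, F (flow T f t z) = χ t * F z) :
    ∃ g : X → ℂ, Measurable g ∧ (∀ᵐ x ∂μ, g (T x) = χ (f x) * g x) ∧
      ∀ᵐ z ∂measure μ f, F z = χ z.2 * g z.1 := by
  set F' := hF.mk F
  set g := transferFunction χ F' c
  have hjump (n : ℕ) (t : ℝ) := ae_apply_sub_birkhoffSum_eq hT hf hc hcf hF.ae_eq_mk (hFt t) n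
  have hg : ∀ᵐ z ∂measure μ f, g z.1 = untwist χ F' z := by
    filter_upwards [ae_untwist_eq_of_ae_apply_eq (S := id) (φ := 0) hχ hf hF.measurable_mk
      measurable_id measurable_zero (by simpa using hjump 0)] with z hz
    exact transferFunction_eq_of_ae_untwist_eq hc (hcf _) (by simpa using hz)
  refine ⟨g, measurable_transferFunction hχ hF.measurable_mk c, ?_, ?_⟩
  · refine ae_of_ae_measure_fst hf (fun x => hc.trans_le (hcf x)) ?_
    filter_upwards [hg, ae_untwist_eq_of_ae_apply_eq hχ hf hF.measurable_mk hT.measurable hf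
      (by simpa using hjump 1)] with z hgz hz
    rw [hgz]
    exact transferFunction_eq_of_ae_untwist_eq hc (hcf _) hz
  · filter_upwards [hF.ae_eq_mk, hg] with z hFz hgz
    rw [hFz, hgz, ← eq_mul_untwist]

theorem exists_measurable_cohomologicalEquation (hχ : Continuous χ)
    (hT : MeasurePreserving T μ μ) (hT' : Measure.QuasiMeasurePreserving T.symm μ μ)
    (hf : AEMeasurable f μ) (hc : 0 < c) (hcf : ∀ᵐ x ∂μ, c ≤ f x)
    (hF : AEMeasurable F (measure μ f))
    (hFt : ∀ t : ℝ, ∀ᵐ z ∂measure μ f, F (flow T f t z) = χ t * F z) :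
    ∃ g : X → ℂ, Measurable g ∧ (∀ᵐ x ∂μ, g (T x) = χ (f x) * g x) ∧
      ∀ᵐ z ∂measure μ f, F z = χ z.2 * g z.1 := by
  set f' : X → ℝ := fun x => max c (hf.mk f x)
  have hff' : f =ᵐ[μ] f' := by
    filter_upwards [hf.ae_eq_mk, hcf] with x hx hcx
    exact hx.trans (max_eq_right (hx ▸ hcx)).symm
  have hflow := ae_measure_of_ae_fst (f := f')
    (ae_forall_zpow_apply hT.quasiMeasurePreserving hT' hff')
  rw [measure_congr hff'] at hF hFt ⊢
  obtain ⟨g, hg, hgT, hFg⟩ := exists_measurable_cohomologicalEquation_of_le hχ hT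
    (measurable_const.max hf.measurable_mk) hc (fun x => le_max_left _ _) hF fun t => by
      filter_upwards [hFt t, hflow] with z hz hfz
      rw [← flow_congr hfz, hz]
  refine ⟨g, hg, ?_, hFg⟩
  filter_upwards [hgT, hff'] with x hx hfx
  rw [hx, hfx]

end TransferFunction

end SpecialFlow

section MainTheorem

variable {X : Type*} [MetricSpace X] [CompactSpace X] [MeasurableSpace X] [BorelSpace X]
  {μ : Measure X} [IsProbabilityMeasure μ] {T : Equiv.Perm X} {f : X → ℝ} {P' : Set ℝ} {η₀ : ℝ}

theorem isWeaklyMixingFlow_of_hasDoubleDrift (hT : Isometry T) (hTμ : Ergodic T μ)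
    (hap : IsAperiodic T μ) (hf : AEMeasurable f μ) (hpos : ∃ c : ℝ, 0 < c ∧ ∀ᵐ x ∂μ, c ≤ f x)
    (hη₀ : 0 < η₀) (h : ∀ η : ℝ, 0 < η → η < η₀ → HasDoubleDrift T μ f P' η) :
    IsWeaklyMixingFlow (SpecialFlow.flow T f) (SpecialFlow.measure μ f) := by
  intro s F hF hFt
  obtain ⟨c, hc, hcf⟩ := hpos
  set χ : AddChar ℝ Circle := Real.fourierChar.mulShift s
  have hχ : Continuous χ := Real.continuous_fourierChar.comp (continuous_const_mul s)
  have hχ_exp (t : ℝ) : (χ t : ℂ) = Complex.exp (2 * Real.pi * s * t * Complex.I) := by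
    simp [χ, AddChar.mulShift_apply, Real.fourierChar_apply, mul_assoc]
  have hT_symm : MeasurePreserving T.symm μ μ :=
    hTμ.toMeasurePreserving.symm
      ⟨T, hTμ.measurable, (hT.right_inv T.right_inv).continuous.measurable⟩
  obtain ⟨g, hg, hgT, hFg⟩ := SpecialFlow.exists_measurable_cohomologicalEquation hχ
    hTμ.toMeasurePreserving hT_symm.quasiMeasurePreserving hf hc hcf
    hF.aestronglyMeasurable.aemeasurable (by simpa only [hχ_exp] using hFt)
  obtain hg_zero | ⟨g', hg', hg'_norm, hg'T⟩ := ae_eq_zero_or_exists_unimodular hTμ hg hgT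
  · refine ⟨0, ?_⟩
    filter_upwards [hFg, SpecialFlow.ae_measure_of_ae_fst hg_zero] with z hz hgz
    rw [hz, hgz, Pi.zero_apply, mul_zero]
  · have hχ_one : χ = 1 := addChar_eq_one_of_forall_Ioo hη₀ fun η hη hηη₀ =>
      addChar_eq_one_of_hasDoubleDrift hT hTμ.toMeasurePreserving hap (h η hη hηη₀) hχ
        hg' hg'_norm hg'T
    obtain ⟨a, ha⟩ := hTμ.ae_eq_const_of_ae_eq_comp_ae hg.aestronglyMeasurable
      (by simpa [hχ_one, Filter.EventuallyEq] using hgT)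
    refine ⟨a, ?_⟩
    filter_upwards [hFg, SpecialFlow.ae_measure_of_ae_fst ha] with z hz hgz
    simp [hz, hgz, hχ_one]

theorem mainTheorem3_general (hT : Isometry T) (hTμ : Ergodic T μ) (hap : IsAperiodic T μ)
    (hf : AEMeasurable f μ) (hpos : ∃ c : ℝ, 0 < c ∧ ∀ᵐ x ∂μ, c ≤ f x) (hP' : IsCompact P')
    (hη₀ : 0 < η₀) (h : ∀ η : ℝ, 0 < η → η < η₀ → HasDoubleDrift T μ f P' η) :
    IsWeaklyMixingFlow (SpecialFlow.flow T f) (SpecialFlow.measure μ f) ∧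
    HasCocycleRatnerProperty T μ f
      ((P' + Set.Icc (-η₀) η₀) \ Set.Ioo (-(η₀ / 4)) (η₀ / 4)) :=
  ⟨isWeaklyMixingFlow_of_hasDoubleDrift hT hTμ hap hf hpos hη₀ h,
    hasCocycleRatnerProperty_of_hasDoubleDrift hP' hη₀
      (h (η₀ / 2) (half_pos hη₀) (half_lt_self hη₀))⟩

end MainTheorem

theorem mainTheorem3 {X : Type*} [AddCommGroup X] [MetricSpace X] [IsTopologicalAddGroup X]
    [CompactSpace X] [MeasurableSpace X] [BorelSpace X]
    (hd : ∀ x y z : X, dist (x + z) (y + z) = dist x y)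
    (μ : Measure X) [μ.IsAddHaarMeasure] [IsProbabilityMeasure μ]
    (x₀ : X) (hT : Ergodic (Equiv.addRight x₀) μ) (hap : IsAperiodic (Equiv.addRight x₀) μ)
    (f : X → ℝ) (hf : MemLp f ∞ μ) (hpos : ∃ c : ℝ, 0 < c ∧ ∀ᵐ x ∂μ, c ≤ f x)
    (P' : Set ℝ) (hP' : IsCompact P') (η₀ : ℝ) (hη₀ : 0 < η₀)
    (h : ∀ η : ℝ, 0 < η → η < η₀ → ∀ ε : ℝ, 0 < ε → ∃ κ : ℝ, 0 < κ ∧ ∀ N : ℕ,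
      ∃ δ : ℝ, 0 < δ ∧ ∃ Z' : Set X, MeasurableSet Z' ∧ 1 - ε < μ.real Z' ∧
        ∀ x ∈ Z', ∀ x' ∈ Z', 0 < dist x x' → dist x x' < δ →
          ∃ M₁ M₂ L₁ L₂ : ℕ, N ≤ M₁ ∧ N ≤ M₂ ∧ N ≤ L₁ ∧ N ≤ L₂ ∧
            κ ≤ (L₁ : ℝ) / M₁ ∧ κ ≤ (L₂ : ℝ) / M₂ ∧
            ∃ p ∈ P',
              1 - ε < ((driftTimes (Equiv.addRight x₀) f x x' p ε M₁ L₁).ncard : ℝ) / L₁ ∧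
              1 - ε < ((driftTimes (Equiv.addRight x₀) f x x' (p + η) ε M₂ L₂).ncard : ℝ) / L₂) :
    IsWeaklyMixingFlow (SpecialFlow.flow (Equiv.addRight x₀) f) (SpecialFlow.measure μ f) ∧
    HasCocycleRatnerProperty (Equiv.addRight x₀) μ f
      ((P' + Set.Icc (-η₀) η₀) \ Set.Ioo (-(η₀ / 4)) (η₀ / 4)) :=
  mainTheorem3_general (Isometry.of_dist_eq fun x y => hd x y x₀) hT hap
    hf.aestronglyMeasurable.aemeasurable hpos hP' hη₀ h
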